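/- Let $0<\rho\le\infty$, $I=(0,\rho)$, and $F:I\to\mathbb R$. Fix $u_0\in(0,1)$ and an integer $N\ge 3$, and let $\mathbf u=(1,u_0,\dots,u_0^{N-1})^T$. For a matrix $A=(a_{ij})$ with entries in $I$ write $F[A]=(F(a_{ij}))$; "positive" means real symmetric positive semidefinite, and $\mathbf 1_{N\times N}$ is the $N\times N$ matrix all of whose entries are $1$. Suppose that (i) $F[A]$ is positive for every positive $2\times2$ matrix $A$ with entries in $I$; and (ii) $F[A]$ is positive for every $N\times N$ Hankel matrix of the form $A=a\mathbf 1_{N\times N}+b\,\mathbf u\mathbf u^T$ with $a\in[0,\rho)$, $b\in[0,\rho-a)$ and $0<a+b<\rho$. Then $F\in C^{N-3}(I)$, with $F^{(k)}(x)\ge 0$ for all $x\in I$ and all integers $0\le k\le N-3$, and $F^{(N-3)}$ is convex and non-decreasing on $I$. If, further, $F\in C^{N-1}(I)$, then $F^{(k)}(x)\ge0$ for all $x\in I$ and all integers $0\le k\le N-1$. All of these conclusions remain true if hypothesis (i) is replaced by the assumption that $F$ is continuous on $I$. -/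

import Mathlib

/-- The open interval `(0, ρ)` of real numbers, for an extended real `ρ` (so `ρ = ⊤` gives
`(0, ∞)`). -/
def openInterval (ρ : EReal) : Set ℝ :=
  {x : ℝ | 0 < x ∧ (x : EReal) < ρ}

/-- The set of positive semidefinite real `n × n` matrices with all entries in `I`. -/
def posMatrices (n : ℕ) (I : Set ℝ) : Set (Matrix (Fin n) (Fin n) ℝ) :=
  {A | A.PosSemidef ∧ ∀ i j, A i j ∈ I}

/-- The vector `(1, u₀, …, u₀ ^ (N - 1))`. -/
def geomVec (N : ℕ) (u₀ : ℝ) : Fin N → ℝ :=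
  fun i => u₀ ^ (i : ℕ)

/-- The family of Hankel matrices `a 𝟏 + b u uᵀ`, where `𝟏` is the all-ones `N × N` matrix,
`u = (1, u₀, …, u₀ ^ (N - 1))`, and `a ∈ [0, ρ)`, `b ∈ [0, ρ - a)`, `0 < a + b < ρ`. -/
def hankelFamily (N : ℕ) (u₀ : ℝ) (ρ : EReal) : Set (Matrix (Fin N) (Fin N) ℝ) :=
  {A | ∃ a b : ℝ, 0 ≤ a ∧ (a : EReal) < ρ ∧ 0 ≤ b ∧ (b : EReal) < ρ - (a : EReal) ∧
    0 < a + b ∧ ((a + b : ℝ) : EReal) < ρ ∧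
    A = a • Matrix.of (fun _ _ => (1 : ℝ)) +
      b • Matrix.vecMulVec (geomVec N u₀) (geomVec N u₀)}

open Filter Topology Set

/-! Testing `F[a𝟏 + t u uᵀ]` against `v` gives `∑ v_i v_j F(a + t u₀^(i+j)) ≥ 0`. The `k`-th moment
of the weights `v_i v_j` at the nodes `u₀^(i+j)` is the square of `∑ v_i u₀^(ik)`. As the `u₀^i` are
distinct, a Vandermonde system yields, for each `m < N`, a `v` whose moments of order below `m`
vanish while the `m`-th is 1. Taylor expansion as `t → 0⁺` then gives `F^(m)(a) ≥ 0` whenever `F` is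
`C^m`.

For merely continuous `F`, mollify: averaging over translates preserves the inequalities, so the
mollified functions have nonnegative derivatives of orders `0, …, N-1` on subintervals. Convexity
carries this to the limit at the cost of two orders: derivatives converge up to order `N-3`, and the
limit of the last is convex and monotone.

The 2×2 hypothesis is used only to make `F` continuous. -/

/-! ### Nonnegative derivatives from moment conditions -/

theorem iteratedDeriv_nonneg_of_sum_nonneg {ι : Type*} [Fintype ι] {f : ℝ → ℝ} {s : Set ℝ}
    (hs : IsOpen s) (hsc : Convex ℝ s) {a : ℝ} (ha : a ∈ s) {m : ℕ} (hf : ContDiffOn ℝ m f s)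
    {w c : ι → ℝ} (hw : ∀ k < m, ∑ i, w i * c i ^ k = 0) (hm : 0 < ∑ i, w i * c i ^ m)
    (hpos : ∀ᶠ t in 𝓝[>] (0 : ℝ), 0 ≤ ∑ i, w i * f (a + t * c i)) :
    0 ≤ iteratedDeriv m f a := by
  rw [← iteratedDerivWithin_of_isOpen hs ha]
  set D := iteratedDerivWithin m f s a
  set R : ℝ → ℝ := fun x ↦ f x - taylorWithinEval f m s a x
  have hR : R =o[𝓝 a] fun x ↦ (x - a) ^ m := by
    have := taylor_isLittleO hsc ha hf
    rwa [hs.nhdsWithin_eq ha] at this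
  have hRi (i : ι) : (fun t ↦ w i * R (a + t * c i)) =o[𝓝[>] (0 : ℝ)] fun t ↦ t ^ m := by
    have ht : Tendsto (fun t : ℝ ↦ a + t * c i) (𝓝[>] 0) (𝓝 a) := by
      have : Tendsto (fun t : ℝ ↦ a + t * c i) (𝓝 0) (𝓝 (a + 0 * c i)) :=
        Continuous.tendsto (by fun_prop) 0
      simp only [zero_mul, add_zero] at this
      exact this.mono_left nhdsWithin_le_nhds
    refine ((hR.comp_tendsto ht).trans_isBigO ?_).const_mul_left (w i)
    simp only [Function.comp_def, add_sub_cancel_left, mul_pow]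
    simpa [mul_comm] using Asymptotics.isBigO_const_mul_self (c i ^ m) (fun t : ℝ ↦ t ^ m) _
  have hsum : (fun t ↦ ∑ i, w i * R (a + t * c i)) =o[𝓝[>] (0 : ℝ)] fun t ↦ t ^ m :=
    Asymptotics.IsLittleO.fun_sum fun i _ ↦ hRi i
  have hT (t : ℝ) : ∑ i, w i * taylorWithinEval f m s a (a + t * c i) =
      t ^ m * (((m.factorial : ℝ)⁻¹ * D) * ∑ i, w i * c i ^ m) := by
    simp only [taylor_within_apply, add_sub_cancel_left, smul_eq_mul, Finset.mul_sum]
    rw [Finset.sum_comm, Finset.sum_range_succ, Finset.sum_eq_zero, zero_add]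
    · exact Finset.sum_congr rfl fun i _ ↦ by simp only [D]; ring
    · intro k hk
      have := hw k (Finset.mem_range.1 hk)
      calc _ = ((k.factorial : ℝ)⁻¹ * t ^ k * iteratedDerivWithin k f s a) *
            ∑ i, w i * c i ^ k := by
              rw [Finset.mul_sum]; exact Finset.sum_congr rfl fun i _ ↦ by ring
        _ = 0 := by rw [this, mul_zero]
  have hlim := hsum.tendsto_div_nhds_zero
  have hge : 0 ≤ ((m.factorial : ℝ)⁻¹ * D) * ∑ i, w i * c i ^ m := by
    have h1 := hlim.add_const (((m.factorial : ℝ)⁻¹ * D) * ∑ i, w i * c i ^ m)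
    rw [zero_add] at h1
    refine ge_of_tendsto h1 ?_
    filter_upwards [hpos, self_mem_nhdsWithin] with t ht ht0
    have ht0 : 0 < t ^ m := pow_pos ht0 m
    have : ∑ i, w i * R (a + t * c i) = (∑ i, w i * f (a + t * c i)) -
        t ^ m * (((m.factorial : ℝ)⁻¹ * D) * ∑ i, w i * c i ^ m) := by
      rw [← hT, ← Finset.sum_sub_distrib]
      exact Finset.sum_congr rfl fun i _ ↦ by simp only [R]; ring
    rw [this, sub_div, mul_div_cancel_left₀ _ ht0.ne', sub_add_cancel]
    positivity
  have h2 := nonneg_of_mul_nonneg_left hge hm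
  exact nonneg_of_mul_nonneg_right h2 (by positivity)

theorem exists_sum_mul_pow_eq_ite {N : ℕ} {x : Fin N → ℝ} (hx : Function.Injective x) (m : Fin N) :
    ∃ v : Fin N → ℝ, ∀ k : Fin N, ∑ i, v i * x i ^ (k : ℕ) = if k = m then 1 else 0 := by
  have hdet : IsUnit (Matrix.vandermonde x).det :=
    isUnit_iff_ne_zero.2 (Matrix.det_vandermonde_ne_zero_iff.2 hx)
  refine ⟨Matrix.vecMul (Pi.single m 1) (Matrix.vandermonde x)⁻¹, fun k ↦ ?_⟩
  have h : Matrix.vecMul (Matrix.vecMul (Pi.single m 1) (Matrix.vandermonde x)⁻¹)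
      (Matrix.vandermonde x) k = (Pi.single m 1 : Fin N → ℝ) k := by
    rw [Matrix.vecMul_vecMul, Matrix.nonsing_inv_mul _ hdet, Matrix.vecMul_one]
  simpa [Matrix.vecMul, dotProduct, Matrix.vandermonde_apply, Pi.single_apply] using h

/-! ### Mollification -/

-- Convolution with a bump of radius at most `δ` averages the inequality over shifts of `a` alone,
-- so only a margin `δ` at each end is lost. One sequence `g` serves all weights, hence all orders
-- of derivative at once.
open scoped Convolution ContDiff in
theorem exists_contDiff_sum_nonneg_tendsto {f : ℝ → ℝ} (hf : Continuous f) {δ : ℝ} (hδ : 0 < δ)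
    (A B : ℝ) :
    ∃ g : ℕ → ℝ → ℝ, (∀ n, ContDiff ℝ ∞ (g n)) ∧
      (∀ x, Tendsto (fun n ↦ g n x) atTop (𝓝 (f x))) ∧
      ∀ (ι : Type) [Fintype ι] (w c : ι → ℝ),
        (∀ a t, A < a → 0 ≤ t → a + t < B → 0 ≤ ∑ i, w i * f (a + t * c i)) →
        ∀ n a t, A + δ < a → 0 ≤ t → a + t < B - δ → 0 ≤ ∑ i, w i * g n (a + t * c i) := by
  let φ : ℕ → ContDiffBump (0 : ℝ) := fun n ↦
    ⟨δ / (n + 1) / 2, δ / (n + 1), by positivity, half_lt_self (by positivity)⟩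
  have hφle (n : ℕ) : (φ n).rOut ≤ δ := div_le_self hδ.le (by simp)
  refine ⟨fun n ↦ (φ n).normed MeasureTheory.volume ⋆[ContinuousLinearMap.lsmul ℝ ℝ] f,
    fun n ↦ (φ n).hasCompactSupport_normed.contDiff_convolution_left _ (φ n).contDiff_normed
      hf.locallyIntegrable,
    fun x ↦ ContDiffBump.convolution_tendsto_right_of_continuous ?_ hf x, ?_⟩
  · exact tendsto_const_nhds.div_atTop (tendsto_natCast_atTop_atTop.atTop_add tendsto_const_nhds)
  intro ι _ w c h n a t ha ht hat
  simp only [MeasureTheory.convolution, ContinuousLinearMap.lsmul_apply, smul_eq_mul]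
  have hint (x : ℝ) : MeasureTheory.Integrable fun y ↦
      (φ n).normed MeasureTheory.volume y * f (x - y) :=
    (((φ n).continuous_normed).mul (by fun_prop)).integrable_of_hasCompactSupport
      (φ n).hasCompactSupport_normed.mul_right
  simp only [← MeasureTheory.integral_const_mul]
  rw [← MeasureTheory.integral_finsetSum _ fun i _ ↦ (hint _).const_mul _]
  refine MeasureTheory.integral_nonneg fun y ↦ ?_
  have : ∑ i, w i * ((φ n).normed MeasureTheory.volume y * f (a + t * c i - y)) =
      (φ n).normed MeasureTheory.volume y * ∑ i, w i * f (a - y + t * c i) := by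
    rw [Finset.mul_sum]
    refine Finset.sum_congr rfl fun i _ ↦ ?_
    rw [add_sub_right_comm]; ring
  simp only [Pi.zero_apply, this]
  by_cases hy : y ∈ Metric.ball (0 : ℝ) (φ n).rOut
  · have hy' : |y| < δ := by
      have := Metric.mem_ball.1 hy
      rw [Real.dist_eq, sub_zero] at this
      exact this.trans_le (hφle n)
    rw [abs_lt] at hy'
    exact mul_nonneg ((φ n).nonneg_normed y) (h _ _ (by linarith) ht (by linarith))
  · have : (φ n).normed MeasureTheory.volume y = 0 := by
      rw [← Function.notMem_support, (φ n).support_normed_eq]; exact hy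
    rw [this, zero_mul]

/-! ### Pointwise limits of functions with nonnegative derivatives -/

theorem ConvexOn.of_tendsto {s : Set ℝ} {g : ℕ → ℝ → ℝ} {f : ℝ → ℝ} (hs : Convex ℝ s)
    (hg : ∀ n, ConvexOn ℝ s (g n)) (h : ∀ x ∈ s, Tendsto (fun n ↦ g n x) atTop (𝓝 (f x))) :
    ConvexOn ℝ s f := by
  refine ⟨hs, fun x hx y hy a b ha hb hab ↦ ?_⟩
  exact le_of_tendsto_of_tendsto' (h _ (hs hx hy ha hb hab))
    (((h x hx).const_smul a).add ((h y hy).const_smul b))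
    fun n ↦ (hg n).2 hx hy ha hb hab

theorem MonotoneOn.of_tendsto {s : Set ℝ} {g : ℕ → ℝ → ℝ} {f : ℝ → ℝ}
    (hg : ∀ n, MonotoneOn (g n) s) (h : ∀ x ∈ s, Tendsto (fun n ↦ g n x) atTop (𝓝 (f x))) :
    MonotoneOn f s :=
  fun x hx y hy hxy ↦ le_of_tendsto_of_tendsto' (h x hx) (h y hy) fun n ↦ hg n hx hy hxy

theorem ConvexOn.mul_deriv_le_sub_le {s : Set ℝ} {g : ℝ → ℝ} (hg : ConvexOn ℝ s g)
    (hd : Differentiable ℝ g) {x y : ℝ} (hx : x ∈ s) (hy : y ∈ s) :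
    (y - x) * deriv g x ≤ g y - g x ∧ g y - g x ≤ (y - x) * deriv g y := by
  have key {x y : ℝ} (hx : x ∈ s) (hy : y ∈ s) (hxy : x < y) :
      (y - x) * deriv g x ≤ g y - g x ∧ g y - g x ≤ (y - x) * deriv g y := by
    have h1 := hg.deriv_le_slope hx hy hxy (hd x)
    have h2 := hg.slope_le_deriv hx hy hxy (hd y)
    have h0 : 0 < y - x := sub_pos.2 hxy
    rw [slope_def_field] at h1 h2
    rw [le_div_iff₀ h0] at h1
    rw [div_le_iff₀ h0] at h2
    constructor <;> linarith
  rcases lt_trichotomy x y with h | rfl | h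
  · exact key hx hy h
  · simp
  · have := key hy hx h
    constructor <;> nlinarith

theorem hasDerivAt_of_mul_le_sub_le {f l : ℝ → ℝ} {x : ℝ} (hl : ContinuousAt l x)
    (h : ∀ᶠ y in 𝓝 x, (y - x) * l x ≤ f y - f x ∧ f y - f x ≤ (y - x) * l y) :
    HasDerivAt f (l x) x := by
  rw [hasDerivAt_iff_isLittleO]
  have h1 : (fun y ↦ l y - l x) =o[𝓝 x] fun _ ↦ (1 : ℝ) := by
    rw [Asymptotics.isLittleO_one_iff]
    simpa using hl.tendsto.sub_const (l x)
  have h2 := (Asymptotics.isBigO_refl (fun y ↦ y - x) (𝓝 x)).mul_isLittleO h1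
  simp only [mul_one] at h2
  refine (Asymptotics.IsBigO.of_bound' ?_).trans_isLittleO h2
  filter_upwards [h] with y hy
  rw [smul_eq_mul, Real.norm_eq_abs, Real.norm_eq_abs]
  exact abs_le_abs_of_nonneg (by linarith) (by linarith)

open scoped ContDiff in
theorem convexOn_iteratedDeriv {g : ℝ → ℝ} (hg : ContDiff ℝ ∞ g) {c d : ℝ} {m : ℕ}
    (h : ∀ x ∈ Ioo c d, 0 ≤ iteratedDeriv (m + 2) g x) :
    ConvexOn ℝ (Ioo c d) (iteratedDeriv m g) := by
  have hk (k : ℕ) : Differentiable ℝ (iteratedDeriv k g) :=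
    hg.differentiable_iteratedDeriv k (by exact_mod_cast WithTop.coe_lt_top _)
  refine convexOn_of_deriv2_nonneg (convex_Ioo c d) (hk m).continuous.continuousOn
    (hk m).differentiableOn ?_ fun x hx ↦ ?_
  · rw [← iteratedDeriv_succ]; exact (hk _).differentiableOn
  · rw [interior_Ioo] at hx
    have := h x hx
    rwa [iteratedDeriv_succ, iteratedDeriv_succ] at this

open scoped ContDiff in
theorem monotoneOn_iteratedDeriv {g : ℝ → ℝ} (hg : ContDiff ℝ ∞ g) {c d : ℝ} {m : ℕ}
    (h : ∀ x ∈ Ioo c d, 0 ≤ iteratedDeriv (m + 1) g x) :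
    MonotoneOn (iteratedDeriv m g) (Ioo c d) := by
  have hk (k : ℕ) : Differentiable ℝ (iteratedDeriv k g) :=
    hg.differentiable_iteratedDeriv k (by exact_mod_cast WithTop.coe_lt_top _)
  refine monotoneOn_of_deriv_nonneg (convex_Ioo c d) (hk m).continuous.continuousOn
    (hk m).differentiableOn fun x hx ↦ ?_
  rw [interior_Ioo] at hx
  have := h x hx
  rwa [iteratedDeriv_succ] at this

-- Each `deriv (g n)` is convex, monotone and eventually bounded at a point right of `x`, so its
-- increments near `x` are small uniformly in `n`. It is thus close to a difference quotient of `g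
-- n` with fixed step, and these quotients converge.
open scoped ContDiff in
theorem cauchySeq_deriv_of_tendsto {g : ℕ → ℝ → ℝ} {f : ℝ → ℝ} {c d : ℝ}
    (hg : ∀ n, ContDiff ℝ ∞ (g n))
    (hpos : ∀ n, ∀ k ≤ 3, ∀ x ∈ Ioo c d, 0 ≤ iteratedDeriv k (g n) x)
    (hlim : ∀ x ∈ Ioo c d, Tendsto (fun n ↦ g n x) atTop (𝓝 (f x))) {x : ℝ} (hx : x ∈ Ioo c d) :
    CauchySeq fun n ↦ deriv (g n) x := by
  have hdiff (n : ℕ) : Differentiable ℝ (g n) := (hg n).differentiable (by simp)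
  have hconv (n : ℕ) : ConvexOn ℝ (Ioo c d) (g n) := by
    simpa using convexOn_iteratedDeriv (m := 0) (hg n) (hpos n 2 (by norm_num))
  have hconv' (n : ℕ) : ConvexOn ℝ (Ioo c d) (deriv (g n)) := by
    simpa using convexOn_iteratedDeriv (m := 1) (hg n) (hpos n 3 le_rfl)
  have hd0 (n : ℕ) {y : ℝ} (hy : y ∈ Ioo c d) : 0 ≤ deriv (g n) y := by
    simpa using hpos n 1 (by norm_num) y hy
  obtain ⟨z, hxz, hzd⟩ := exists_between hx.2
  obtain ⟨w, hzw, hwd⟩ := exists_between hzd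
  have hz : z ∈ Ioo c d := ⟨hx.1.trans hxz, hzd⟩
  have hw : w ∈ Ioo c d := ⟨hz.1.trans hzw, hwd⟩
  have hzx : 0 < z - x := sub_pos.2 hxz
  have hwz : 0 < w - z := sub_pos.2 hzw
  set M : ℝ := max 0 ((f w - f z) / (w - z)) + 1
  have hM : 0 < M := by positivity
  have hbound : ∀ᶠ n in atTop, deriv (g n) z ≤ M := by
    have h1 : Tendsto (fun n ↦ (g n w - g n z) / (w - z)) atTop (𝓝 ((f w - f z) / (w - z))) :=
      ((hlim w hw).sub (hlim z hz)).div_const _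
    have h2 : (f w - f z) / (w - z) < M := (le_max_right _ _).trans_lt (lt_add_one _)
    filter_upwards [h1.eventually_lt_const h2] with n hn
    refine le_trans ?_ hn.le
    rw [le_div_iff₀ hwz, mul_comm]
    exact ((hconv n).mul_deriv_le_sub_le (hdiff n) hz hw).1
  rw [Metric.cauchySeq_iff']
  intro ε hε
  -- The last bound makes `deriv (g n)` vary by less than `ε / 4` over `[x - h, x + h]`, its secant
  -- slope there being at most `M / (z - x)`.
  obtain ⟨h, h0, hh⟩ : ∃ h : ℝ, 0 < h ∧ h < min (min (x - c) (z - x)) (ε / 8 * (z - x) / M) :=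
    exists_between (lt_min (lt_min (sub_pos.2 hx.1) hzx) (by positivity))
  obtain ⟨⟨hhc, hhz⟩, hhε⟩ : (h < x - c ∧ h < z - x) ∧ h < ε / 8 * (z - x) / M := by
    simpa only [lt_min_iff] using hh
  have hp : x + h ∈ Ioo c d := ⟨by linarith [hx.1], by linarith⟩
  have hm : x - h ∈ Ioo c d := ⟨by linarith, by linarith [hx.2]⟩
  have hS : Tendsto (fun n ↦ (g n (x + h) - g n x) / h) atTop (𝓝 ((f (x + h) - f x) / h)) :=
    ((hlim _ hp).sub (hlim x hx)).div_const _
  have hclose : ∀ᶠ n in atTop, dist (deriv (g n) x) ((f (x + h) - f x) / h) < ε / 2 := by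
    filter_upwards [hbound, Metric.tendsto_nhds.1 hS (ε / 4) (by positivity)] with n hn hSn
    obtain ⟨h1, h2⟩ := (hconv n).mul_deriv_le_sub_le (hdiff n) hx hp
    obtain ⟨h3, h4⟩ := (hconv n).mul_deriv_le_sub_le (hdiff n) hm hx
    have h5 := (hconv' n).secant_mono hm hp hz (by linarith) (by linarith) (by linarith)
    have h6 : (deriv (g n) z - deriv (g n) (x - h)) / (z - (x - h)) ≤ M / (z - x) :=
      div_le_div₀ hM.le (by linarith [hd0 n hm]) hzx (by linarith)
    have h7 := h5.trans h6
    rw [div_le_iff₀ (by linarith)] at h7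
    have h8 : M / (z - x) * h < ε / 8 := by
      rw [lt_div_iff₀ hM] at hhε
      rw [div_mul_eq_mul_div, div_lt_iff₀ hzx]
      linarith
    have h9 : (g n (x + h) - g n x) / h ≤ deriv (g n) (x + h) := by
      rw [div_le_iff₀ h0]; linarith
    have h10 : deriv (g n) x ≤ (g n (x + h) - g n x) / h := by
      rw [le_div_iff₀ h0]; linarith
    have h11 : deriv (g n) (x - h) ≤ deriv (g n) x := by
      have : h * deriv (g n) (x - h) ≤ h * deriv (g n) x := by linarith
      exact le_of_mul_le_mul_left this h0
    rw [Real.dist_eq, abs_lt] at hSn ⊢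
    constructor <;> linarith
  obtain ⟨n₀, hn₀⟩ := eventually_atTop.1 hclose
  refine ⟨n₀, fun n hn ↦ ?_⟩
  have h1 := hn₀ n hn
  have h2 := hn₀ n₀ le_rfl
  rw [dist_comm] at h2
  linarith [dist_triangle (deriv (g n) x) ((f (x + h) - f x) / h) (deriv (g n₀) x)]

open scoped ContDiff in
theorem differentiableAt_tendsto_deriv_of_tendsto {g : ℕ → ℝ → ℝ} {f : ℝ → ℝ} {c d : ℝ}
    (hg : ∀ n, ContDiff ℝ ∞ (g n))
    (hpos : ∀ n, ∀ k ≤ 3, ∀ x ∈ Ioo c d, 0 ≤ iteratedDeriv k (g n) x)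
    (hlim : ∀ x ∈ Ioo c d, Tendsto (fun n ↦ g n x) atTop (𝓝 (f x))) {x : ℝ} (hx : x ∈ Ioo c d) :
    DifferentiableAt ℝ f x ∧ Tendsto (fun n ↦ deriv (g n) x) atTop (𝓝 (deriv f x)) := by
  have hdiff (n : ℕ) : Differentiable ℝ (g n) := (hg n).differentiable (by simp)
  have hconv (n : ℕ) : ConvexOn ℝ (Ioo c d) (g n) := by
    simpa using convexOn_iteratedDeriv (m := 0) (hg n) (hpos n 2 (by norm_num))
  have hconv' (n : ℕ) : ConvexOn ℝ (Ioo c d) (deriv (g n)) := by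
    simpa using convexOn_iteratedDeriv (m := 1) (hg n) (hpos n 3 le_rfl)
  have hex (y : ℝ) : ∃ l, y ∈ Ioo c d → Tendsto (fun n ↦ deriv (g n) y) atTop (𝓝 l) := by
    by_cases hy : y ∈ Ioo c d
    · obtain ⟨l, hl⟩ := cauchySeq_tendsto_of_complete (cauchySeq_deriv_of_tendsto hg hpos hlim hy)
      exact ⟨l, fun _ ↦ hl⟩
    · exact ⟨0, fun h ↦ absurd h hy⟩
  choose l hl using hex
  have hlconv : ConvexOn ℝ (Ioo c d) l := .of_tendsto (convex_Ioo c d) hconv' hl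
  have hlc : ContinuousAt l x :=
    (hlconv.continuousOn isOpen_Ioo).continuousAt (isOpen_Ioo.mem_nhds hx)
  have hd : HasDerivAt f (l x) x := by
    refine hasDerivAt_of_mul_le_sub_le hlc ?_
    filter_upwards [isOpen_Ioo.mem_nhds hx] with y hy
    have hsub := (hlim y hy).sub (hlim x hx)
    exact ⟨le_of_tendsto_of_tendsto' ((hl x hx).const_mul _) hsub
        fun n ↦ ((hconv n).mul_deriv_le_sub_le (hdiff n) hx hy).1,
      le_of_tendsto_of_tendsto' hsub ((hl y hy).const_mul _)
        fun n ↦ ((hconv n).mul_deriv_le_sub_le (hdiff n) hx hy).2⟩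
  exact ⟨hd.differentiableAt, hd.deriv ▸ hl x hx⟩

-- Each induction step replaces `g n` by its derivative and uses orders up to 3; the base case needs
-- order 2 for convexity, hence continuity of the limit. This is the surplus `m + 2`.
open scoped ContDiff in
theorem contDiffOn_tendsto_iteratedDeriv_of_tendsto {c d : ℝ} (m : ℕ) {g : ℕ → ℝ → ℝ} {f : ℝ → ℝ}
    (hg : ∀ n, ContDiff ℝ ∞ (g n))
    (hpos : ∀ n, ∀ k ≤ m + 2, ∀ x ∈ Ioo c d, 0 ≤ iteratedDeriv k (g n) x)
    (hlim : ∀ x ∈ Ioo c d, Tendsto (fun n ↦ g n x) atTop (𝓝 (f x))) :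
    ContDiffOn ℝ m f (Ioo c d) ∧ ∀ k ≤ m, ∀ x ∈ Ioo c d,
      Tendsto (fun n ↦ iteratedDeriv k (g n) x) atTop (𝓝 (iteratedDeriv k f x)) := by
  induction m generalizing g f with
  | zero =>
    constructor
    · rw [Nat.cast_zero, contDiffOn_zero]
      refine ConvexOn.continuousOn isOpen_Ioo (.of_tendsto (convex_Ioo c d) (fun n ↦ ?_) hlim)
      simpa using convexOn_iteratedDeriv (m := 0) (hg n) (hpos n 2 le_rfl)
    · intro k hk x hx
      obtain rfl : k = 0 := by omega
      simpa using hlim x hx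
  | succ m ih =>
    have hd (x : ℝ) (hx : x ∈ Ioo c d) := differentiableAt_tendsto_deriv_of_tendsto hg
      (fun n k hk ↦ hpos n k (by omega)) hlim hx
    obtain ⟨h1, h2⟩ := ih (g := fun n ↦ deriv (g n)) (f := deriv f)
      (fun n ↦ ((contDiff_infty_iff_deriv).1 (hg n)).2)
      (fun n k hk x hx ↦ by
        rw [← iteratedDeriv_succ']; exact hpos n (k + 1) (by omega) x hx)
      (fun x hx ↦ (hd x hx).2)
    constructor
    · push_cast
      rw [contDiffOn_succ_iff_deriv_of_isOpen isOpen_Ioo]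
      exact ⟨fun x hx ↦ (hd x hx).1.differentiableWithinAt, by simp, h1⟩
    · rintro (_ | k) hk x hx
      · simpa using hlim x hx
      · simp only [iteratedDeriv_succ']
        exact h2 k (by omega) x hx

theorem isOpen_openInterval (ρ : EReal) : IsOpen (openInterval ρ) :=
  (isOpen_lt continuous_const continuous_id).inter
    (isOpen_lt continuous_coe_real_ereal continuous_const)

theorem mem_openInterval_of_le {ρ : EReal} {x y : ℝ} (hx : 0 < x) (hxy : x ≤ y)
    (hy : y ∈ openInterval ρ) : x ∈ openInterval ρ :=
  ⟨hx, (EReal.coe_le_coe_iff.2 hxy).trans_lt hy.2⟩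

theorem convex_openInterval (ρ : EReal) : Convex ℝ (openInterval ρ) :=
  Set.OrdConnected.convex
    ⟨fun _ hx _ hy _ hz ↦ mem_openInterval_of_le (hx.1.trans_le hz.1) hz.2 hy⟩

theorem exists_gt_mem_openInterval {ρ : EReal} {x : ℝ} (hx : x ∈ openInterval ρ) :
    ∃ y ∈ openInterval ρ, x < y := by
  obtain ⟨y, hy1, hy2⟩ := EReal.lt_iff_exists_real_btwn.1 hx.2
  have hxy : x < y := EReal.coe_lt_coe_iff.1 hy1
  exact ⟨y, ⟨hx.1.trans hxy, hy2⟩, hxy⟩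

/-! ### Continuity from 2×2 matrices -/

section TwoByTwo

variable {F : ℝ → ℝ} {ρ : EReal}

theorem posSemidef_two {x y z : ℝ} (hx : 0 < x) (h : y ^ 2 ≤ x * z) :
    (!![x, y; y, z] : Matrix (Fin 2) (Fin 2) ℝ).PosSemidef := by
  refine .of_dotProduct_mulVec_nonneg ?_ fun v ↦ ?_
  · ext i j; fin_cases i <;> fin_cases j <;> simp
  · simp only [Matrix.mulVec, dotProduct, Fin.sum_univ_two, star_trivial, Matrix.of_apply,
      Matrix.cons_val', Matrix.cons_val_zero, Matrix.cons_val_one, Matrix.cons_val_fin_one]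
    -- Multiplying by `x` completes the square: `(x v₀ + y v₁)² + (xz - y²) v₁²`.
    refine (mul_nonneg_iff_of_pos_left hx).1 ?_
    nlinarith [sq_nonneg (x * v 0 + y * v 1), mul_nonneg (sub_nonneg.2 h) (sq_nonneg (v 1))]

theorem sq_le_mul_of_posMatrices
    (hF : ∀ A ∈ posMatrices 2 (openInterval ρ), A.map F ∈ posMatrices 2 Set.univ)
    {x y z : ℝ} (hx : x ∈ openInterval ρ) (hy : y ∈ openInterval ρ) (hz : z ∈ openInterval ρ)
    (h : y ^ 2 ≤ x * z) : 0 ≤ F x ∧ F y ^ 2 ≤ F x * F z := by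
  have hA := (hF !![x, y; y, z] ⟨posSemidef_two hx.1 h, fun i j ↦ by
    fin_cases i <;> fin_cases j <;> simpa⟩).1
  have hd := hA.det_nonneg
  have h0 := hA.diag_nonneg (i := 0)
  simp only [Matrix.det_fin_two, Matrix.map_apply, Matrix.of_apply, Matrix.cons_val',
    Matrix.cons_val_zero, Matrix.cons_val_one, Matrix.cons_val_fin_one] at hd h0
  exact ⟨h0, by nlinarith⟩

theorem continuousOn_of_posMatrices
    (hF : ∀ A ∈ posMatrices 2 (openInterval ρ), A.map F ∈ posMatrices 2 Set.univ) :
    ContinuousOn F (openInterval ρ) := by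
  have hnn {x : ℝ} (hx : x ∈ openInterval ρ) : 0 ≤ F x :=
    (sq_le_mul_of_posMatrices hF hx hx hx (sq x).le).1
  have hmono : MonotoneOn F (openInterval ρ) := fun x hx y hy hxy ↦ by
    have := (sq_le_mul_of_posMatrices hF hy hx hy (by nlinarith [hx.1])).2
    exact abs_le_of_sq_le_sq' (by rwa [← sq] at this) (hnn hy) |>.2
  intro x hx
  have hnhds := (isOpen_openInterval ρ).mem_nhds hx
  obtain ⟨y, hy, hxy⟩ := exists_gt_mem_openInterval hx
  have hIoo : Ioo 0 y ⊆ openInterval ρ := fun z hz ↦ mem_openInterval_of_le hz.1 hz.2.le hy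
  have hleft : ∃ L, Tendsto F (𝓝[<] x) (𝓝 L) := by
    have h := (hmono.mono ((Ioo_subset_Ioo_right hxy.le).trans hIoo)).tendsto_nhdsWithin_Ioo_left
      (nonempty_Ioo.2 hx.1) ⟨F x, by
        rintro _ ⟨z, hz, rfl⟩
        exact hmono (hIoo ⟨hz.1, hz.2.trans hxy⟩) hx hz.2.le⟩
    exact ⟨_, h⟩
  have hright : ∃ R, Tendsto F (𝓝[>] x) (𝓝 R) := by
    have h := (hmono.mono ((Ioo_subset_Ioo_left hx.1.le).trans hIoo)).tendsto_nhdsWithin_Ioo_right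
      (nonempty_Ioo.2 hxy) ⟨F x, by
        rintro _ ⟨z, hz, rfl⟩
        exact hmono hx (hIoo ⟨hx.1.trans hz.1, hz.2⟩) hz.1.le⟩
    exact ⟨_, h⟩
  obtain ⟨L, hL⟩ := hleft
  obtain ⟨R, hR⟩ := hright
  have hLx : L ≤ F x := by
    refine le_of_tendsto hL ?_
    filter_upwards [nhdsWithin_le_nhds hnhds, self_mem_nhdsWithin] with z hz hzx
    exact hmono hz hx (le_of_lt hzx)
  have hxR : F x ≤ R := by
    refine ge_of_tendsto hR ?_
    filter_upwards [nhdsWithin_le_nhds hnhds, self_mem_nhdsWithin] with z hz hzx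
    exact hmono hx hz (le_of_lt hzx)
  have hL0 : 0 ≤ L := by
    refine ge_of_tendsto hL ?_
    filter_upwards [nhdsWithin_le_nhds hnhds] with z hz using hnn hz
  have htend (r : ℝ) : Tendsto (fun t ↦ x * Real.exp (r * t)) (𝓝[>] 0) (𝓝 x) := by
    have : Tendsto (fun t ↦ x * Real.exp (r * t)) (𝓝 0) (𝓝 (x * Real.exp (r * 0))) :=
      Continuous.tendsto (by fun_prop) 0
    rw [mul_zero, Real.exp_zero, mul_one] at this
    exact this.mono_left nhdsWithin_le_nhds
  have htR {r : ℝ} (hr : 0 < r) : Tendsto (fun t ↦ x * Real.exp (r * t)) (𝓝[>] 0) (𝓝[>] x) := by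
    refine tendsto_nhdsWithin_iff.2 ⟨htend r, ?_⟩
    filter_upwards [self_mem_nhdsWithin] with t ht
    exact lt_mul_of_one_lt_right hx.1 (Real.one_lt_exp_iff.2 (mul_pos hr ht))
  have htL : Tendsto (fun t ↦ x * Real.exp (-1 * t)) (𝓝[>] 0) (𝓝[<] x) := by
    refine tendsto_nhdsWithin_iff.2 ⟨htend (-1), ?_⟩
    filter_upwards [self_mem_nhdsWithin] with t ht
    exact mul_lt_of_lt_one_right hx.1 (Real.exp_lt_one_iff.2 (by linarith [mem_Ioi.1 ht]))
  -- The exponent 1 is the mean of -1 and 3, so the matrix is singular; only the point with exponent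
  -- -1 approaches `x` from the left, which rules out a jump.
  have hRL : R ^ 2 ≤ L * R := by
    refine le_of_tendsto_of_tendsto ((hR.comp (htR one_pos)).pow 2)
      ((hL.comp htL).mul (hR.comp (htR three_pos))) ?_
    filter_upwards [htend (-1) hnhds, htend 1 hnhds, htend 3 hnhds] with t h1 h2 h3
    refine (sq_le_mul_of_posMatrices hF h1 h2 h3 (le_of_eq ?_)).2
    rw [mul_pow, ← Real.exp_nat_mul, mul_mul_mul_comm, ← Real.exp_add, sq]
    congr 2; push_cast; ring
  have hRL' : R ≤ L := by
    rcases (hL0.trans (hLx.trans hxR)).eq_or_lt with h | h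
    · rwa [← h]
    · exact le_of_mul_le_mul_right (by rwa [← sq]) h
  have e1 : L = F x := le_antisymm hLx (hxR.trans hRL')
  have e2 : R = F x := le_antisymm (hRL'.trans hLx) hxR
  refine (continuousAt_iff_continuous_left'_right'.2 ⟨?_, ?_⟩).continuousWithinAt
  · rwa [e1] at hL
  · rwa [e2] at hR

end TwoByTwo

/-! ### Consequences of the Hankel hypothesis -/

section Hankel

variable {F : ℝ → ℝ} {ρ : EReal} {N : ℕ} {u₀ : ℝ}

theorem sum_nonneg_of_hankelFamily
    (hH : ∀ A ∈ hankelFamily N u₀ ρ, A.map F ∈ posMatrices N Set.univ) (v : Fin N → ℝ) {a t : ℝ}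
    (ha : 0 < a) (ht : 0 ≤ t) (hat : a + t ∈ openInterval ρ) :
    0 ≤ ∑ p : Fin N × Fin N, v p.1 * v p.2 * F (a + t * u₀ ^ (p.1 + p.2 : ℕ)) := by
  have hmem : a • Matrix.of (fun _ _ => (1 : ℝ)) +
      t • Matrix.vecMulVec (geomVec N u₀) (geomVec N u₀) ∈ hankelFamily N u₀ ρ := by
    refine ⟨a, t, ha.le, (mem_openInterval_of_le ha (by linarith) hat).2, ht, ?_, hat.1, hat.2, rfl⟩
    rw [EReal.lt_sub_iff_add_lt (by simp) (by simp), add_comm, ← EReal.coe_add]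
    exact hat.2
  have h := (hH _ hmem).1.dotProduct_mulVec_nonneg v
  simp only [dotProduct, Matrix.mulVec, star_trivial, Matrix.map_apply, Matrix.add_apply,
    Matrix.smul_apply, Matrix.of_apply, Matrix.vecMulVec_apply, geomVec, smul_eq_mul, mul_one,
    Finset.mul_sum] at h
  rw [Fintype.sum_prod_type]
  refine h.trans_eq (Finset.sum_congr rfl fun i _ ↦ Finset.sum_congr rfl fun j _ ↦ ?_)
  rw [pow_add]; ring

theorem exists_weights_of_hankelFamily (hu₀ : u₀ ∈ Ioo (0 : ℝ) 1)
    (hH : ∀ A ∈ hankelFamily N u₀ ρ, A.map F ∈ posMatrices N Set.univ) {m : ℕ} (hm : m < N) :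
    ∃ w c : Fin N × Fin N → ℝ, (∀ p, c p ∈ Icc (0 : ℝ) 1) ∧ (∀ k < m, ∑ p, w p * c p ^ k = 0) ∧
      0 < ∑ p, w p * c p ^ m ∧
      ∀ a t, 0 < a → 0 ≤ t → a + t ∈ openInterval ρ → 0 ≤ ∑ p, w p * F (a + t * c p) := by
  have hinj : Function.Injective fun i : Fin N ↦ u₀ ^ (i : ℕ) := fun i j hij ↦
    Fin.ext (pow_right_injective₀ hu₀.1 hu₀.2.ne hij)
  obtain ⟨v, hv⟩ := exists_sum_mul_pow_eq_ite hinj ⟨m, hm⟩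
  have hsq (k : ℕ) : ∑ p : Fin N × Fin N, v p.1 * v p.2 * (u₀ ^ (p.1 + p.2 : ℕ)) ^ k =
      (∑ i, v i * (u₀ ^ (i : ℕ)) ^ k) ^ 2 := by
    rw [sq, Finset.sum_mul_sum, Fintype.sum_prod_type]
    refine Finset.sum_congr rfl fun i _ ↦ Finset.sum_congr rfl fun j _ ↦ ?_
    rw [pow_add]; ring
  refine ⟨fun p ↦ v p.1 * v p.2, fun p ↦ u₀ ^ (p.1 + p.2 : ℕ), fun p ↦
    ⟨pow_nonneg hu₀.1.le _, pow_le_one₀ hu₀.1.le hu₀.2.le⟩, fun k hk ↦ ?_, ?_,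
    fun a t ha ht hat ↦ sum_nonneg_of_hankelFamily hH v ha ht hat⟩
  · have := hv ⟨k, hk.trans hm⟩
    simp only [Fin.mk.injEq, hk.ne, if_false] at this
    rw [hsq, this]; norm_num
  · have := hv ⟨m, hm⟩
    simp only [if_true] at this
    rw [hsq, this]; norm_num

theorem iteratedDeriv_nonneg_of_hankelFamily (hu₀ : u₀ ∈ Ioo (0 : ℝ) 1)
    (hH : ∀ A ∈ hankelFamily N u₀ ρ, A.map F ∈ posMatrices N Set.univ) {m : ℕ} (hm : m < N)
    (hF : ContDiffOn ℝ m F (openInterval ρ)) {x : ℝ} (hx : x ∈ openInterval ρ) :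
    0 ≤ iteratedDeriv m F x := by
  obtain ⟨w, c, -, h0, h1, hpos⟩ := exists_weights_of_hankelFamily hu₀ hH hm
  refine iteratedDeriv_nonneg_of_sum_nonneg (isOpen_openInterval ρ) (convex_openInterval ρ) hx hF
    h0 h1 ?_
  obtain ⟨y, hy, hxy⟩ := exists_gt_mem_openInterval hx
  filter_upwards [Ioo_mem_nhdsGT (sub_pos.2 hxy)] with t ht
  exact hpos x t hx.1 ht.1.le
    (mem_openInterval_of_le (by linarith [hx.1, ht.1]) (by linarith [ht.2]) hy)

open scoped ContDiff in
theorem exists_contDiff_tendsto_of_hankelFamily (hu₀ : u₀ ∈ Ioo (0 : ℝ) 1)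
    (hH : ∀ A ∈ hankelFamily N u₀ ρ, A.map F ∈ posMatrices N Set.univ)
    (hF : ContinuousOn F (openInterval ρ)) {c d : ℝ} (hc : 0 < c) (hcd : c < d)
    (hd : d ∈ openInterval ρ) :
    ∃ g : ℕ → ℝ → ℝ, (∀ n, ContDiff ℝ ∞ (g n)) ∧
      (∀ n, ∀ k < N, ∀ x ∈ Ioo c d, 0 ≤ iteratedDeriv k (g n) x) ∧
      ∀ x ∈ Ioo c d, Tendsto (fun n ↦ g n x) atTop (𝓝 (F x)) := by
  obtain ⟨e, he, hde⟩ := exists_gt_mem_openInterval hd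
  obtain ⟨δ, hδ0, hδ⟩ : ∃ δ, 0 < δ ∧ δ < min c (e - d) :=
    exists_between (lt_min hc (sub_pos.2 hde))
  obtain ⟨hδc, hδe⟩ := lt_min_iff.1 hδ
  have hAB : c - δ ≤ d + δ := by linarith
  -- Freezing `F` outside `[c - δ, d + δ]` gives a function continuous on all of `ℝ`, as convolution
  -- requires. Nodes in `[0, 1]` keep every sample inside this interval.
  set f : ℝ → ℝ := fun x ↦ F (projIcc (c - δ) (d + δ) hAB x)
  have hsub : Icc (c - δ) (d + δ) ⊆ openInterval ρ := fun x hx ↦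
    mem_openInterval_of_le (by linarith [hx.1]) (by linarith [hx.2]) he
  have hfc : Continuous f :=
    hF.comp_continuous (continuous_subtype_val.comp continuous_projIcc)
      fun x ↦ hsub (projIcc (c - δ) (d + δ) hAB x).2
  have hfF {x : ℝ} (hx : x ∈ Icc (c - δ) (d + δ)) : f x = F x := by
    simp only [f, projIcc_of_mem hAB hx]
  obtain ⟨g, hg, hlim, hpos⟩ := exists_contDiff_sum_nonneg_tendsto hfc hδ0 (c - δ) (d + δ)
  refine ⟨g, hg, fun n k hk x hx ↦ ?_, fun x hx ↦ ?_⟩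
  · obtain ⟨w, u, hu, h0, h1, hwpos⟩ := exists_weights_of_hankelFamily hu₀ hH hk
    have hg' := hpos _ w u fun a t ha ht hat ↦ by
      have h2 := hwpos a t (by linarith) ht
        (mem_openInterval_of_le (by linarith) (by linarith) he)
      refine h2.trans_eq (Finset.sum_congr rfl fun p _ ↦ ?_)
      rw [hfF]
      have := mul_nonneg ht (hu p).1
      have := mul_le_of_le_one_right ht (hu p).2
      constructor <;> linarith
    refine iteratedDeriv_nonneg_of_sum_nonneg isOpen_univ convex_univ (mem_univ x)
      ((hg n).of_le (by exact_mod_cast le_top)).contDiffOn h0 h1 ?_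
    filter_upwards [Ioo_mem_nhdsGT (sub_pos.2 hx.2)] with t ht
    exact hg' n x t (by linarith [hx.1]) ht.1.le (by linarith [ht.2])
  · rw [← hfF ⟨by linarith [hx.1], by linarith [hx.2]⟩]
    exact hlim x

end Hankel

/-- The function on `(0, ρ)` is given by the values on `(0, ρ)` of `F : ℝ → ℝ`; no other value of
`F` enters the hypotheses or the conclusion. `A.map F` is the entrywise image of `A`. -/
theorem theorem3p5 (F : ℝ → ℝ) (ρ : EReal) (hρ : 0 < ρ) (u₀ : ℝ) (hu₀ : u₀ ∈ Set.Ioo (0 : ℝ) 1)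
    (N : ℕ) (hN : 3 ≤ N)
    (hF : (∀ A ∈ posMatrices 2 (openInterval ρ), A.map F ∈ posMatrices 2 Set.univ) ∨
      ContinuousOn F (openInterval ρ))
    (hH : ∀ A ∈ hankelFamily N u₀ ρ, A.map F ∈ posMatrices N Set.univ) :
    ContDiffOn ℝ ((N - 3 : ℕ) : WithTop ℕ∞) F (openInterval ρ) ∧
    (∀ x ∈ openInterval ρ, ∀ k : ℕ, k ≤ N - 3 →
      0 ≤ iteratedDerivWithin k F (openInterval ρ) x) ∧
    ConvexOn ℝ (openInterval ρ) (iteratedDerivWithin (N - 3) F (openInterval ρ)) ∧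
    MonotoneOn (iteratedDerivWithin (N - 3) F (openInterval ρ)) (openInterval ρ) ∧
    (ContDiffOn ℝ ((N - 1 : ℕ) : WithTop ℕ∞) F (openInterval ρ) →
      ∀ x ∈ openInterval ρ, ∀ k : ℕ, k ≤ N - 1 →
        0 ≤ iteratedDerivWithin k F (openInterval ρ) x) := by
  have hFc : ContinuousOn F (openInterval ρ) := hF.elim continuousOn_of_posMatrices id
  have hopen := isOpen_openInterval ρ
  have heq (k : ℕ) : EqOn (iteratedDerivWithin k F (openInterval ρ)) (iteratedDeriv k F)
      (openInterval ρ) := iteratedDerivWithin_of_isOpen hopen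
  have hlocal {c d : ℝ} (hc : 0 < c) (hcd : c < d) (hd : d ∈ openInterval ρ) :
      ContDiffOn ℝ (N - 3 : ℕ) F (Ioo c d) ∧
      ConvexOn ℝ (Ioo c d) (iteratedDeriv (N - 3) F) ∧
      MonotoneOn (iteratedDeriv (N - 3) F) (Ioo c d) := by
    obtain ⟨g, hg, hpos, hlim⟩ := exists_contDiff_tendsto_of_hankelFamily hu₀ hH hFc hc hcd hd
    obtain ⟨h1, h2⟩ := contDiffOn_tendsto_iteratedDeriv_of_tendsto (N - 3) hg
      (fun n k hk ↦ hpos n k (by omega)) hlim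
    exact ⟨h1, .of_tendsto (convex_Ioo c d)
      (fun n ↦ convexOn_iteratedDeriv (hg n) (hpos n _ (by omega))) (h2 _ le_rfl),
      .of_tendsto
      (fun n ↦ monotoneOn_iteratedDeriv (hg n) (hpos n _ (by omega))) (h2 _ le_rfl)⟩
  -- Convexity and monotonicity compare two points at a time, so a common subinterval for each pair
  -- passes from local to global.
  have hpair {x y : ℝ} (hx : x ∈ openInterval ρ) (hy : y ∈ openInterval ρ) :
      ∃ c d, 0 < c ∧ c < d ∧ d ∈ openInterval ρ ∧ x ∈ Ioo c d ∧ y ∈ Ioo c d := by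
    obtain ⟨c, hc0, hc⟩ := exists_between (lt_min hx.1 hy.1)
    obtain ⟨hcx, hcy⟩ := lt_min_iff.1 hc
    obtain ⟨d, hd, hmd⟩ := exists_gt_mem_openInterval
      (max_rec' (· ∈ openInterval ρ) hx hy)
    obtain ⟨hxd, hyd⟩ := max_lt_iff.1 hmd
    exact ⟨c, d, hc0, hcx.trans hxd, hd, ⟨hcx, hxd⟩, ⟨hcy, hyd⟩⟩
  have hsmooth : ContDiffOn ℝ (N - 3 : ℕ) F (openInterval ρ) := fun x hx ↦ by
    obtain ⟨c, d, hc, hcd, hd, hx', -⟩ := hpair hx hx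
    exact ((hlocal hc hcd hd).1.contDiffAt (isOpen_Ioo.mem_nhds hx')).contDiffWithinAt
  have hnonneg {n : ℕ} (hn : n < N) (hn' : ContDiffOn ℝ n F (openInterval ρ)) :
      ∀ x ∈ openInterval ρ, ∀ k ≤ n, 0 ≤ iteratedDerivWithin k F (openInterval ρ) x := by
    intro x hx k hk
    rw [heq k hx]
    exact iteratedDeriv_nonneg_of_hankelFamily hu₀ hH (hk.trans_lt hn)
      (hn'.of_le (by exact_mod_cast hk)) hx
  refine ⟨hsmooth, hnonneg (by omega) hsmooth, ?_, ?_, hnonneg (by omega)⟩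
  · refine ConvexOn.congr ⟨convex_openInterval ρ, fun x hx y hy a b ha hb hab ↦ ?_⟩ (heq _).symm
    obtain ⟨c, d, hc, hcd, hd, hx', hy'⟩ := hpair hx hy
    exact (hlocal hc hcd hd).2.1.2 hx' hy' ha hb hab
  · refine MonotoneOn.congr (fun x hx y hy hxy ↦ ?_) (heq _).symm
    obtain ⟨c, d, hc, hcd, hd, hx', hy'⟩ := hpair hx hy
    exact (hlocal hc hcd hd).2.2 hx' hy' hxy
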